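/- All graphs are simple; graphs may be infinite where so stated. A graph has infinite chromatic number if it has no proper vertex colouring with finitely many colours. A family $\mathcal{F}$ of graphs is called durable if there exists an infinite graph $H$ with infinite chromatic number such that every induced subgraph of $H$ with infinite chromatic number contains every member of $\mathcal{F}$ as an induced subgraph. The girth of a graph is the length of its shortest cycle, and is $\infty$ if the graph has no cycle. Theorem. For every integer $g$, the family of all finite graphs of girth at least $g$ is not durable. That is, there is no infinite graph $H$ with infinite chromatic number such that every induced subgraph of $H$ with infinite chromatic number contains every finite graph of girth at least $g$ as an induced subgraph. -/

import Mathlib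

universe u w

/-- A (possibly infinite) family of graphs. -/
abbrev GraphFamily : Type (w + 1) := Set (Σ W : Type w, SimpleGraph W)

/-- `G` has infinite chromatic number: it has no proper colouring with finitely many colours. -/
def InfiniteChromatic {V : Type u} (G : SimpleGraph V) : Prop :=
  G.chromaticNumber = ⊤

/-- An infinite graph `G` of infinite chromatic number is a witness of the durability of `𝓕` if
every induced subgraph of `G` of infinite chromatic number contains every member of `𝓕` as an
induced subgraph. -/
structure IsDurabilityWitness {V : Type u} (G : SimpleGraph V) (𝓕 : GraphFamily.{w}) : Prop where
  infinite : Infinite V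
  infiniteChromatic : InfiniteChromatic G
  contains : ∀ S : Set V, InfiniteChromatic (G.induce S) →
    ∀ F ∈ 𝓕, SimpleGraph.IsIndContained F.2 (G.induce S)

/-- A family of graphs is durable if there is a witness of its durability
(a graph with vertex set in the universe `u`). -/
def Durable (𝓕 : GraphFamily.{w}) : Prop :=
  ∃ (V : Type u) (G : SimpleGraph V), IsDurabilityWitness G 𝓕

/-- The family of finite graphs of girth at least `g`. Acyclic graphs have girth `⊤`, so they
belong to the family for every `g`; for `g ≤ 0` the condition on the girth is void. -/
def girthFamily (g : ℤ) : GraphFamily.{w} :=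
  {F | Finite F.1 ∧ (g.toNat : ℕ∞) ≤ F.2.egirth}

/-! Suppose `G` is a witness, and let `F` be a finite non-bipartite graph of finite girth L at least
max(g, 4), given by Erdős' theorem. Every set of infinite chromatic number contains Erdős graphs of
girth above L. Sorting its vertices by their adjacency to such a finite copy, then halving the copy,
gives a piece of large chromatic number that is complete or anticomplete to a set still of infinite
chromatic number (`exists_piece`). Iterating there, and keeping infinitely many pieces of one type,
gives a union of infinite chromatic number, which must contain `F`. But a shortest cycle of `F` then
lies in a single piece (`exists_egirth_induce_le`), whose girth exceeds L. -/

open Finset in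
/-- The functions that map every element of `T` into `A` form a proportion `(#A / #α) ^ #T` of all
functions. -/
theorem card_filter_forall_mem_mul {ι α : Type*} [Fintype ι] [DecidableEq ι] [Fintype α]
    [DecidableEq α] (T : Finset ι) (A : Finset α) :
    #{ω : ι → α | ∀ e ∈ T, ω e ∈ A} * Fintype.card α ^ #T
      = #A ^ #T * Fintype.card (ι → α) := by
  have h : ({ω : ι → α | ∀ e ∈ T, ω e ∈ A} : Finset (ι → α))
      = Fintype.piFinset fun e => if e ∈ T then A else univ := by
    ext ω
    simp only [mem_filter, mem_univ, true_and, Fintype.mem_piFinset]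
    refine forall_congr' fun e => ?_
    by_cases he : e ∈ T <;> simp [he]
  have hprod : ∏ e : ι, #(if e ∈ T then A else (univ : Finset α))
      = #A ^ #T * Fintype.card α ^ (Fintype.card ι - #T) := by
    simp only [apply_ite Finset.card, card_univ]
    rw [prod_ite, prod_const, prod_const, filter_mem_eq_inter, univ_inter, filter_not,
      filter_mem_eq_inter, univ_inter, ← compl_eq_univ_sdiff, card_compl]
  rw [h, Fintype.card_piFinset, hprod, mul_assoc, ← pow_add,
    Nat.sub_add_cancel (card_le_univ T), Fintype.card_fun]

/-! ### Erdős' theorem by counting random edge labellings -/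

namespace SimpleGraph

open Finset

section Counting

variable {V : Type*} [Fintype V] [DecidableEq V]

theorem sum_card_finsetWalkLength_top_le (n : ℕ) (v : V) :
    ∑ u, #((⊤ : SimpleGraph V).finsetWalkLength n u v) ≤ Fintype.card V ^ n := by
  have hsucc : ∀ m u, #((⊤ : SimpleGraph V).finsetWalkLength (m + 1) u v)
      ≤ ∑ x, #((⊤ : SimpleGraph V).finsetWalkLength m x v) := by
    intro m u
    rw [finsetWalkLength]
    refine card_biUnion_le.trans ?_
    simp only [card_map]
    rw [sum_set_coe (f := fun x => #((⊤ : SimpleGraph V).finsetWalkLength m x v))]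
    exact sum_le_univ_sum_of_nonneg fun _ => Nat.zero_le _
  induction n with
  | zero =>
    rw [pow_zero, sum_eq_single v]
    · simp [finsetWalkLength]
    · intro u _ hu
      simp [finsetWalkLength, hu]
    · simp
  | succ n ih =>
    calc ∑ u, #((⊤ : SimpleGraph V).finsetWalkLength (n + 1) u v)
        ≤ ∑ _u : V, Fintype.card V ^ n := sum_le_sum fun u _ => (hsucc n u).trans ih
      _ = Fintype.card V ^ (n + 1) := by simp [pow_succ, mul_comm]

theorem card_finsetWalkLength_top_le (n : ℕ) (u v : V) :
    #((⊤ : SimpleGraph V).finsetWalkLength (n + 1) u v) ≤ Fintype.card V ^ n := by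
  rw [finsetWalkLength]
  refine card_biUnion_le.trans ?_
  simp only [card_map]
  rw [sum_set_coe (f := fun x => #((⊤ : SimpleGraph V).finsetWalkLength n x v))]
  exact (sum_le_univ_sum_of_nonneg fun _ => Nat.zero_le _).trans
    (sum_card_finsetWalkLength_top_le n v)

open scoped Classical in
/-- The cycles of length `n` of the complete graph on `V`. -/
noncomputable def topCycles (V : Type*) [Fintype V] [DecidableEq V] (n : ℕ) :
    Finset (Σ v : V, (⊤ : SimpleGraph V).Walk v v) :=
  {p ∈ univ.sigma fun v => (⊤ : SimpleGraph V).finsetWalkLength n v v | p.2.IsCycle}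

theorem mem_topCycles {n : ℕ} {p : Σ v : V, (⊤ : SimpleGraph V).Walk v v} :
    p ∈ topCycles V n ↔ p.2.length = n ∧ p.2.IsCycle := by
  simp [topCycles, mem_finsetWalkLength_iff]

theorem card_topCycles_le {n : ℕ} (hn : 1 ≤ n) : #(topCycles V n) ≤ Fintype.card V ^ n := by
  classical
  obtain ⟨m, rfl⟩ := Nat.exists_eq_add_of_le' hn
  refine (card_filter_le _ _).trans ?_
  rw [card_sigma]
  calc ∑ v : V, #((⊤ : SimpleGraph V).finsetWalkLength (m + 1) v v)
      ≤ ∑ _v : V, Fintype.card V ^ m := sum_le_sum fun v _ => card_finsetWalkLength_top_le m v v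
    _ = Fintype.card V ^ (m + 1) := by simp [pow_succ, mul_comm]

theorem card_filter_forall_mem_eq {ι α : Type*} [Fintype ι] [DecidableEq ι] [Fintype α]
    [DecidableEq α] [Nonempty α] (T : Finset ι) (A : Finset α) :
    (#{ω : ι → α | ∀ e ∈ T, ω e ∈ A} : ℝ)
      = ((#A : ℝ) / Fintype.card α) ^ #T * Fintype.card (ι → α) := by
  have h0 : (Fintype.card α : ℝ) ≠ 0 := Nat.cast_ne_zero.2 Fintype.card_ne_zero
  have h := congrArg (Nat.cast : ℕ → ℝ) (card_filter_forall_mem_mul T A)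
  push_cast at h
  rw [div_pow, div_mul_eq_mul_div, eq_div_iff (pow_ne_zero _ h0)]
  exact_mod_cast h

theorem sum_card_filter_comm {α β : Type*} (s : Finset α) (t : Finset β) (r : α → β → Prop)
    [∀ a b, Decidable (r a b)] :
    ∑ a ∈ s, (#{b ∈ t | r a b} : ℝ) = ∑ b ∈ t, (#{a ∈ s | r a b} : ℝ) := by
  exact_mod_cast sum_card_bipartiteAbove_eq_sum_card_bipartiteBelow r (s := s) (t := t)

/-- The n edges of a cycle are distinct, so all get label 0 with probability q⁻ⁿ. Label 0 means
"edge" throughout. -/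
theorem sum_card_topCycles_le (q n : ℕ) [NeZero q] (hn : 1 ≤ n) :
    ∑ ω : Sym2 V → Fin q,
        (#{p ∈ topCycles V n | ∀ e ∈ p.2.edges.toFinset, ω e ∈ ({0} : Finset _)} : ℝ)
      ≤ ((Fintype.card V : ℝ) / q) ^ n * Fintype.card (Sym2 V → Fin q) := by
  rw [sum_card_filter_comm]
  calc _ = ∑ p ∈ topCycles V n, ((1 : ℝ) / q) ^ n * Fintype.card (Sym2 V → Fin q) := by
        refine sum_congr rfl fun p hp => ?_
        obtain ⟨hl, hc⟩ := mem_topCycles.1 hp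
        rw [card_filter_forall_mem_eq, List.toFinset_card_of_nodup hc.edges_nodup,
          Walk.length_edges, hl]
        simp
    _ = #(topCycles V n) * (((1 : ℝ) / q) ^ n * Fintype.card (Sym2 V → Fin q)) := by simp
    _ ≤ (Fintype.card V : ℝ) ^ n * (((1 : ℝ) / q) ^ n * Fintype.card (Sym2 V → Fin q)) := by
        gcongr
        exact_mod_cast card_topCycles_le hn
    _ = _ := by rw [← mul_assoc, ← mul_pow, mul_one_div]

theorem sum_card_powersetCard_le (q s : ℕ) [NeZero q] :
    ∑ ω : Sym2 V → Fin q, (#{A ∈ powersetCard s (univ : Finset V) |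
        ∀ e ∈ A.offDiag.image Sym2.mk.uncurry, ω e ∈ ({0}ᶜ : Finset _)} : ℝ)
      ≤ 2 ^ Fintype.card V * Real.exp (-(s.choose 2 / q)) * Fintype.card (Sym2 V → Fin q) := by
  have hq : (0 : ℝ) < q := Nat.cast_pos.2 (NeZero.pos q)
  have hq1 : 1 ≤ q := NeZero.one_le
  rw [sum_card_filter_comm]
  calc _ = ∑ A ∈ powersetCard s (univ : Finset V), (1 - 1 / q : ℝ) ^ s.choose 2
          * Fintype.card (Sym2 V → Fin q) := by
        refine sum_congr rfl fun A hA => ?_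
        rw [card_filter_forall_mem_eq, Sym2.card_image_offDiag, (mem_powersetCard.1 hA).2,
          card_compl, card_singleton, Fintype.card_fin, Nat.cast_sub hq1, sub_div,
          div_self hq.ne', Nat.cast_one]
    _ = (Fintype.card V).choose s * ((1 - 1 / q : ℝ) ^ s.choose 2
          * Fintype.card (Sym2 V → Fin q)) := by simp
    _ ≤ 2 ^ Fintype.card V * (Real.exp (-(s.choose 2 / q))
          * Fintype.card (Sym2 V → Fin q)) := by
        have h1 : (0 : ℝ) ≤ 1 - 1 / q := by
          rw [sub_nonneg, div_le_one hq]
          exact_mod_cast hq1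
        have h2 : (1 - 1 / q : ℝ) ^ s.choose 2 ≤ Real.exp (-(s.choose 2 / q)) := by
          calc (1 - 1 / q : ℝ) ^ s.choose 2 ≤ Real.exp (-(1 / q)) ^ s.choose 2 := by
                gcongr
                exact Real.one_sub_le_exp_neg _
            _ = _ := by
                rw [← Real.exp_nat_mul]
                congr 1
                ring
        gcongr
        exact_mod_cast Nat.choose_le_two_pow _ _
    _ = _ := by ring

/-- With s = 16kq the exponent s(s-1)/(2q) equals 8k(s-1), which outweighs 2ks. -/
theorem two_pow_mul_exp_le {k q s : ℕ} (hk : 1 ≤ k) (hq : 1 ≤ q) (hs : s = 16 * k * q) :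
    (2 : ℝ) ^ (2 * k * s) * Real.exp (-(s.choose 2 / q)) ≤ 1 / 4 := by
  have hq' : (1 : ℝ) ≤ q := by exact_mod_cast hq
  have hk' : (1 : ℝ) ≤ k := by exact_mod_cast hk
  have hsr : (s : ℝ) = 16 * k * q := by exact_mod_cast hs
  have hs16 : (16 : ℝ) ≤ s := by rw [hsr]; nlinarith
  have hks : (16 : ℝ) ≤ k * s := by nlinarith
  have hc : (s.choose 2 : ℝ) / q = 8 * k * (s - 1) := by
    rw [Nat.cast_choose_two, div_eq_iff (by positivity), hsr]
    ring
  have h2 : (2 : ℝ) ^ (2 * k * s) ≤ Real.exp (2 * k * s) := by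
    have h := pow_le_pow_left₀ (by norm_num) (by linarith [Real.add_one_le_exp (1 : ℝ)] :
      (2 : ℝ) ≤ Real.exp 1) (2 * k * s)
    rw [← Real.exp_nat_mul] at h
    simpa using h
  calc _ ≤ Real.exp (2 * k * s) * Real.exp (-(s.choose 2 / q)) := by gcongr
    _ = Real.exp (2 * k * s - 8 * k * (s - 1)) := by rw [← Real.exp_add, hc]; ring_nf
    _ ≤ Real.exp (-4) := Real.exp_le_exp.2 (by nlinarith)
    _ ≤ 1 / 4 := by
        rw [Real.exp_neg, one_div]
        exact inv_anti₀ (by norm_num) (by linarith [Real.add_one_le_exp (4 : ℝ)])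

/-- First moments: |V|/q = 32k² does not depend on q, so the expected number of short cycles is at
most a constant C, while ks grows with q. -/
theorem exists_few_cycles_and_no_independent (k g : ℕ) (hk : 1 ≤ k) : ∃ s q : ℕ, ∃ _ : NeZero q,
    ∀ (V : Type w) [Fintype V] [DecidableEq V], Fintype.card V = 2 * k * s →
    ∃ ω : Sym2 V → Fin q,
      ∑ n ∈ Icc 1 g, #{p ∈ topCycles V n | ∀ e ∈ p.2.edges, ω e = 0} < k * s ∧
      ∀ A : Finset V, #A = s → ∃ u ∈ A, ∃ v ∈ A, u ≠ v ∧ ω s(u, v) = 0 := by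
  set C : ℝ := ∑ n ∈ Icc 1 g, (32 * k ^ 2 : ℝ) ^ n with hC
  obtain ⟨q, hq⟩ := exists_nat_gt C
  have hC0 : 0 ≤ C := sum_nonneg fun _ _ => by positivity
  have hq0 : (0 : ℝ) < q := hC0.trans_lt hq
  have hq1 : 1 ≤ q := by exact_mod_cast hq0
  have hne : NeZero q := ⟨by omega⟩
  refine ⟨16 * k * q, q, hne, fun V _ _ hV => ?_⟩
  set s := 16 * k * q with hs
  set N : ℝ := (Fintype.card (Sym2 V → Fin q) : ℝ) with hN
  have hN0 : 0 < N := by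
    have : Nonempty (Sym2 V → Fin q) := ⟨fun _ => 0⟩
    exact Nat.cast_pos.2 Fintype.card_pos
  have hk' : (1 : ℝ) ≤ k := by exact_mod_cast hk
  have hsr : (s : ℝ) = 16 * k * q := by exact_mod_cast hs
  have hVq : (Fintype.card V : ℝ) / q = 32 * k ^ 2 := by
    rw [hV, div_eq_iff hq0.ne']
    push_cast
    rw [hsr]
    ring
  have hks : 2 * C < k * s := by
    rw [hsr]
    nlinarith [mul_le_mul hk' hk' zero_le_one (by positivity)]
  let I : (Sym2 V → Fin q) → ℕ := fun ω => #{A ∈ powersetCard s (univ : Finset V) |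
        ∀ e ∈ A.offDiag.image Sym2.mk.uncurry, ω e ∈ ({0}ᶜ : Finset _)}
  let Y : (Sym2 V → Fin q) → ℕ := fun ω =>
    ∑ n ∈ Icc 1 g, #{p ∈ topCycles V n | ∀ e ∈ p.2.edges.toFinset, ω e ∈ ({0} : Finset _)}
  have hI : ∑ ω, (I ω : ℝ) ≤ 1 / 4 * N := by
    refine (sum_card_powersetCard_le q s).trans ?_
    rw [hV]
    gcongr
    exact two_pow_mul_exp_le hk hq1 hs
  have hY : ∑ ω, (Y ω : ℝ) ≤ C * N := by
    simp only [Y, Nat.cast_sum]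
    rw [sum_comm, hC, sum_mul]
    refine sum_le_sum fun n hn => ?_
    refine (sum_card_topCycles_le q n (mem_Icc.1 hn).1).trans ?_
    rw [hVq]
  -- The weight ks on independent sets makes one inequality give both `I ω = 0` and `Y ω < k * s`.
  obtain ⟨ω, -, hω⟩ : ∃ ω ∈ (univ : Finset (Sym2 V → Fin q)),
      (k * s * I ω + Y ω : ℝ) < k * s := by
    refine exists_lt_of_sum_lt ?_
    rw [sum_add_distrib, ← mul_sum, sum_const, nsmul_eq_mul, card_univ, ← hN]
    calc _ ≤ k * s * (1 / 4 * N) + C * N := by gcongr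
      _ < N * (k * s) := by nlinarith
  have hω' : k * s * I ω + Y ω < k * s := by exact_mod_cast hω
  have hI0 : I ω = 0 := by
    by_contra h
    have : k * s * 1 ≤ k * s * I ω := Nat.mul_le_mul_left _ (Nat.one_le_iff_ne_zero.2 h)
    omega
  refine ⟨ω, ?_, fun A hA => ?_⟩
  · have : Y ω < k * s := by omega
    simpa [Y] using this
  · by_contra! hcon
    refine (card_pos.2 ⟨A, ?_⟩).ne' hI0
    simp only [mem_filter, mem_powersetCard, subset_univ, true_and, mem_image, mem_offDiag,
      Prod.exists, mem_compl, mem_singleton]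
    refine ⟨hA, ?_⟩
    rintro _ ⟨u, v, ⟨hu, hv, huv⟩, rfl⟩
    exact hcon u hu v hv huv

/-- **Erdős' theorem**: there are finite graphs of arbitrarily large girth and chromatic number. -/
theorem exists_le_egirth_and_not_colorable (k g : ℕ) :
    ∃ (W : Type w) (G : SimpleGraph W), Finite W ∧ (g : ℕ∞) ≤ G.egirth ∧ ¬ G.Colorable k := by
  wlog hk : 1 ≤ k generalizing k
  · obtain ⟨W, G, hW, hg, hG⟩ := this 1 le_rfl
    exact ⟨W, G, hW, hg, fun h => hG (h.mono (by omega))⟩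
  obtain ⟨s, q, hq, H⟩ := exists_few_cycles_and_no_independent k g hk
  let V := ULift.{w} (Fin (2 * k * s))
  obtain ⟨ω, hY, hI⟩ := H V (by simp [V])
  let G : SimpleGraph V := fromEdgeSet {e | ω e = 0}
  -- Delete the base point of every short cycle; more than half of the vertices survive, so a
  -- k-colouring has a class of at least s of them.
  let R : Finset V := (Icc 1 g).biUnion fun n =>
    ({p ∈ topCycles V n | ∀ e ∈ p.2.edges, ω e = 0} : Finset _).image Sigma.fst
  have hR : #R < k * s :=
    (card_biUnion_le.trans (sum_le_sum fun n _ => card_image_le)).trans_lt hY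
  refine ⟨{v // v ∉ R}, G.comap Subtype.val, inferInstance, ?_, ?_⟩
  · rw [le_egirth]
    intro a w hw
    by_contra! hlt
    have hlt : w.length < g := by exact_mod_cast hlt
    let f : G.comap (Subtype.val : {v // v ∉ R} → V) →g G := ⟨Subtype.val, fun h => h⟩
    have hw' : (w.map f).IsCycle := hw.map Subtype.val_injective
    let p : (⊤ : SimpleGraph V).Walk a.1 a.1 := (w.map f).mapLe le_top
    have hp : p.IsCycle := hw'.mapLe le_top
    refine a.2 ?_
    refine mem_biUnion.2 ⟨w.length, mem_Icc.2 ⟨?_, hlt.le⟩,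
      mem_image.2 ⟨⟨a.1, p⟩, mem_filter.2 ⟨mem_topCycles.2
        ⟨(Walk.length_map _ _).trans (Walk.length_map _ _), hp⟩, ?_⟩, rfl⟩⟩
    · exact (by norm_num : 1 ≤ 3).trans hw.three_le_length
    · intro e he
      have he' : e ∈ (w.map f).edges := by
        rwa [← Walk.edges_mapLe_eq_edges le_top (w.map f)]
      have := (w.map f).edges_subset_edgeSet he'
      simp only [G, edgeSet_fromEdgeSet] at this
      exact this.1
  · rintro ⟨c⟩
    have hs : 0 < s := Nat.pos_of_ne_zero (by rintro rfl; simp at hR)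
    have hcard : k * (s - 1) < #(univ : Finset {v // v ∉ R}) := by
      rw [card_univ, Fintype.card_subtype_compl, Fintype.card_coe]
      have h1 : Fintype.card V = 2 * k * s := by simp [V]
      have h2 : k * (s - 1) ≤ k * s := Nat.mul_le_mul_left _ (Nat.sub_le _ _)
      have h3 : 2 * k * s = k * s + k * s := by ring
      omega
    obtain ⟨i, -, hi⟩ := exists_lt_card_fiber_of_mul_lt_card_of_maps_to
      (s := univ) (t := (univ : Finset (Fin k))) (f := c) (n := s - 1) (fun _ _ => mem_univ _)
      (by simpa using hcard)
    obtain ⟨A, hAi, hA⟩ := exists_subset_card_eq (Nat.le_of_pred_lt hi)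
    obtain ⟨u, hu, v, hv, huv, h0⟩ := hI (A.map (Function.Embedding.subtype _)) (by simpa using hA)
    obtain ⟨u, hu', rfl⟩ := mem_map.1 hu
    obtain ⟨v, hv', rfl⟩ := mem_map.1 hv
    refine c.valid (v := u) (w := v) ?_ ?_
    · simpa [G] using ⟨h0, fun h => huv (by simp [h])⟩
    · rw [(mem_filter.1 (hAi hu')).2, (mem_filter.1 (hAi hv')).2]

end Counting

end SimpleGraph

/-! ### Colourings and vertex partitions -/

namespace SimpleGraph

theorem colorable_induce_of_forall_fiber {V ι : Type*} [Fintype ι] {G : SimpleGraph V} {S : Set V}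
    (τ : V → ι) {K : ℕ} (h : ∀ i, (G.induce {v ∈ S | τ v = i}).Colorable K) :
    (G.induce S).Colorable (Fintype.card ι * K) := by
  let c : ∀ i, (G.induce {v ∈ S | τ v = i}).Coloring (Fin K) := fun i => (h i).some
  have hc : ∀ (v : S) (i) (hi : τ v = i), c (τ v) ⟨v, v.2, rfl⟩ = c i ⟨v, v.2, hi⟩ := by
    rintro v _ rfl
    rfl
  let C : (G.induce S).Coloring (ι × Fin K) :=
    Coloring.mk (fun v => (τ v, c (τ v) ⟨v, v.2, rfl⟩)) <| by
      intro v w hvw heq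
      obtain ⟨h1, h2⟩ := Prod.mk.inj heq
      rw [hc v _ h1] at h2
      exact (c (τ w)).valid (v := ⟨v, v.2, h1⟩) (w := ⟨w, w.2, rfl⟩) hvw h2
  simpa using C.colorable

theorem induce_isIndContained_induce {V : Type*} (G : SimpleGraph V) {S T : Set V} (h : S ⊆ T) :
    (G.induce S).IsIndContained (G.induce T) :=
  ⟨G.induceHomOfLE h⟩

/-- A graph of girth at least four that is not bipartite has no partition into two nonempty sides
complete to each other. -/
theorem colorable_two_of_complete_partition {V : Type*} {G : SimpleGraph V} (hG : 4 ≤ G.egirth)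
    {A : Set V} (hA : A.Nonempty) (hA' : Aᶜ.Nonempty) (h : ∀ a ∈ A, ∀ b ∈ Aᶜ, G.Adj a b) :
    G.Colorable 2 := by
  classical
  have htri : ∀ x y z, G.Adj x y → G.Adj y z → G.Adj z x → False := by
    intro x y z hxy hyz hzx
    set w : G.Walk x x := .cons hxy <| .cons hyz <| .cons hzx .nil with hw
    have h1 := hxy.ne
    have h2 := hyz.ne
    have h3 := hzx.ne
    have : w.IsCycle :=
      { edges_nodup := by aesop
        ne_nil := by aesop
        support_nodup := by aesop }
    have h4 := hG.trans (egirth_le_length this)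
    simp only [hw, Walk.length_cons, Walk.length_nil] at h4
    norm_num at h4
  obtain ⟨a, ha⟩ := hA
  obtain ⟨b, hb⟩ := hA'
  let C : G.Coloring Prop := Coloring.mk (fun v => v ∈ A) <| by
    intro v w hvw heq
    -- An edge within one side forms a triangle with any vertex of the other.
    by_cases hv : v ∈ A
    · exact htri v w b hvw (h w (heq ▸ hv) b hb) (h v hv b hb).symm
    · exact htri v w a hvw (h a ha w (fun hw => hv (heq ▸ hw))).symm (h a ha v hv)
  simpa using C.colorable

end SimpleGraph

/-! ### Extracting pieces and refuting durability -/

open SimpleGraph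

theorem infiniteChromatic_iff {V : Type*} {G : SimpleGraph V} :
    InfiniteChromatic G ↔ ∀ n, ¬ G.Colorable n := by
  rw [InfiniteChromatic, ← not_iff_not, ← Ne, chromaticNumber_ne_top_iff_exists]
  push Not
  rfl

/-- Otherwise colouring by fibre and by colour within the fibre uses finitely many colours. -/
theorem InfiniteChromatic.exists_fiber {V ι : Type*} [Finite ι] {G : SimpleGraph V} {S : Set V}
    (hS : InfiniteChromatic (G.induce S)) (τ : V → ι) :
    ∃ i, InfiniteChromatic (G.induce {v ∈ S | τ v = i}) := by
  have := Fintype.ofFinite ι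
  by_contra! h
  simp only [infiniteChromatic_iff, not_forall, not_not] at h hS
  choose k hk using h
  exact hS _ (colorable_induce_of_forall_fiber τ (K := ∑ i, k i) fun i =>
    (hk i).mono (Finset.single_le_sum (f := k) (fun _ _ => Nat.zero_le _) (Finset.mem_univ i)))

/-- Inside a set `S` all of whose subgraphs of infinite chromatic number contain all finite graphs
of girth at least `m`, there are a piece `P` of large girth and chromatic number and a set `S'` of
infinite chromatic number such that `P` is either complete or anticomplete to `S'`. -/
theorem exists_piece {V : Type u} {G : SimpleGraph V} {m : ℕ} {S : Set V}
    (hS : InfiniteChromatic (G.induce S))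
    (h : ∀ (W : Type w) (F : SimpleGraph W), Finite W → (m : ℕ∞) ≤ F.egirth →
      F.IsIndContained (G.induce S)) (n : ℕ) :
    ∃ (P S' : Set V) (b : Prop), P ⊆ S ∧ S' ⊆ S ∧ ¬ (G.induce P).Colorable n ∧
      (m : ℕ∞) ≤ (G.induce P).egirth ∧ InfiniteChromatic (G.induce S') ∧
      ∀ p ∈ P, ∀ v ∈ S', p ≠ v ∧ (G.Adj p v ↔ b) := by
  classical
  -- The factor 2 pays for the later split of the copy into two halves.
  obtain ⟨W, E, hW, hE, hEn⟩ := exists_le_egirth_and_not_colorable.{w} (2 * n) m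
  obtain ⟨f⟩ := h W E hW hE
  let Q : Set V := Set.range fun e => (f e : V)
  have hQS : Q ⊆ S := by
    rintro _ ⟨e, rfl⟩
    exact (f e).2
  have hQfin : Finite Q := Set.finite_range _
  have hinj : Function.Injective fun e => (f e : V) := Subtype.val_injective.comp f.injective
  let toQ : E →g G.induce Q := ⟨fun e => ⟨f e, e, rfl⟩, fun {a b} hab => f.map_adj_iff.2 hab⟩
  have hQE : (G.induce Q).IsContained E := by
    let e := Equiv.ofInjective _ hinj
    refine ⟨⟨⟨e.symm, fun {a b} hab => ?_⟩, e.symm.injective⟩⟩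
    obtain ⟨a, rfl⟩ := e.surjective a
    obtain ⟨b, rfl⟩ := e.surjective b
    rw [e.symm_apply_apply, e.symm_apply_apply]
    exact f.map_adj_iff.1 hab
  have hQn : ¬ (G.induce Q).Colorable (2 * n) := fun hc => hEn (hc.of_hom toQ)
  -- The type of v records its equality and adjacency with each vertex of the finite set `Q`, so
  -- there are finitely many types. A fibre meeting `Q` would be a single vertex.
  obtain ⟨τ, hτ⟩ := hS.exists_fiber fun v (p : Q) => (p.1 = v, G.Adj p v)
  have hne : ∀ p : Q, ¬ (τ p).1 := by
    intro p hp
    have hsub : Subsingleton {v ∈ S | (fun p : Q => (p.1 = v, G.Adj p v)) = τ} := by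
      have key : ∀ v ∈ {v ∈ S | (fun p : Q => (p.1 = v, G.Adj p v)) = τ}, p.1 = v := by
        rintro v ⟨-, hv⟩
        rw [← hv] at hp
        exact hp
      exact ⟨fun x y => Subtype.ext ((key x x.2).symm.trans (key y y.2))⟩
    exact infiniteChromatic_iff.1 hτ 1 
      (chromaticNumber_le_iff_colorable.1 (chromaticNumber_le_one_of_subsingleton _))
  obtain ⟨b, hb⟩ : ∃ b : Prop, 
      ¬ (G.induce {v ∈ Q | (∃ hv : v ∈ Q, (τ ⟨v, hv⟩).2) = b}).Colorable n := by
    by_contra! hcol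
    have := colorable_induce_of_forall_fiber (fun v => ∃ hv : v ∈ Q, (τ ⟨v, hv⟩).2) hcol
    exact hQn (by simpa using this)
  refine ⟨_, _, b, (Set.sep_subset _ _).trans hQS, Set.sep_subset _ _, hb, ?_, hτ, ?_⟩
  · exact (hE.trans hQE.egirth_le).trans
      (induce_isIndContained_induce G (Set.sep_subset _ _)).isContained.egirth_le
  · rintro p ⟨hp, hpb⟩ v ⟨-, hv⟩
    have h1 := hne ⟨p, hp⟩
    rw [← hpb, ← hv] at *
    refine ⟨h1, fun h => ⟨hp, h⟩, fun ⟨_, h⟩ => h⟩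

/-- Suppose that `F` is embedded into a family of pieces that are pairwise complete to each other,
or pairwise anticomplete to each other. If `F` is not bipartite and has girth at least four, then
one of the pieces has girth at most that of `F`. -/
theorem exists_egirth_induce_le {V W : Type*} {G : SimpleGraph V} {F : SimpleGraph W}
    (hF : 4 ≤ F.egirth) (hF2 : ¬ F.Colorable 2) (f : F ↪g G) (P : ℕ → Set V) (b : Prop)
    (idx : W → ℕ) (hidx : ∀ x, f x ∈ P (idx x))
    (hadj : ∀ x y, idx x ≠ idx y → (G.Adj (f x) (f y) ↔ b)) :
    ∃ x, (G.induce (P (idx x))).egirth ≤ F.egirth := by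
  have hacyc : ¬ F.IsAcyclic := fun h => hF2 h.colorable_two
  obtain ⟨a, c, hc, hcl⟩ := exists_egirth_eq_length.2 hacyc
  have hconst : ∀ x ∈ c.support, idx x = idx a := by
    -- Complete pieces: a second index would split `F` into two sides complete to each other, making
    -- it bipartite. Anticomplete pieces: the index is constant along walks.
    by_cases hb : b
    · intro x _
      by_contra hx
      refine hF2 (colorable_two_of_complete_partition hF (A := {y | idx y = idx a}) ⟨a, rfl⟩
        ⟨x, hx⟩ ?_)
      intro y hy z hz
      rw [← f.map_adj_iff, hadj y z]
      · exact hb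
      · exact fun h => hz (h.symm.trans hy)
    · intro x hx
      have hedge : ∀ y z, F.Adj y z → idx y = idx z := by
        intro y z hyz
        by_contra hne
        exact hb ((hadj y z hne).1 (f.map_adj_iff.2 hyz))
      have hwalk : ∀ {y z} (p : F.Walk y z), idx y = idx z := by
        intro y z p
        induction p with
        | nil => rfl
        | cons h _ ih => exact (hedge _ _ h).trans ih
      classical exact (hwalk (c.takeUntil x hx)).symm
  refine ⟨a, ?_⟩
  let s : Set W := {x | idx x = idx a}
  have hcs : (c.induce s hconst).IsCycle := by
    refine .of_map (f := (Embedding.induce s).toHom) ?_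
    rwa [Walk.map_induce]
  have hcont : (F.induce s).IsContained (G.induce (P (idx a))) := by
    refine ⟨⟨⟨fun x => ⟨f x, x.2 ▸ hidx x⟩, fun {x y} hxy => f.map_adj_iff.2 hxy⟩, ?_⟩⟩
    intro x y hxy
    exact Subtype.ext (f.injective (congrArg Subtype.val hxy))
  refine hcont.egirth_le.trans ((egirth_le_length hcs).trans_eq ?_)
  rw [hcl, ← Walk.length_map (Embedding.induce s).toHom, Walk.map_induce]
  rfl

theorem theorem1p5 (g : ℤ) : ¬ Durable.{u, w} (girthFamily.{w} g) := by
  rintro ⟨V, G, -, hG, hcont⟩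
  obtain ⟨W, F, hW, hFg, hF2⟩ := exists_le_egirth_and_not_colorable.{w} 2 (max g.toNat 4)
  have hFg' : (g.toNat : ℕ∞) ≤ F.egirth := le_trans (by exact_mod_cast le_max_left _ _) hFg
  have hF4 : (4 : ℕ∞) ≤ F.egirth := le_trans (by exact_mod_cast le_max_right _ _) hFg
  obtain ⟨L, hL⟩ := ENat.ne_top_iff_exists.1 (egirth_eq_top.not.2 fun h => hF2 h.colorable_two)
  have hstep : ∀ (S : {S : Set V // InfiniteChromatic (G.induce S)}) (n : ℕ),
      ∃ (P : Set V) (S' : {S : Set V // InfiniteChromatic (G.induce S)}) (b : Prop),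
        P ⊆ S.1 ∧ S'.1 ⊆ S.1 ∧ ¬ (G.induce P).Colorable n ∧
        ((L + 1 : ℕ) : ℕ∞) ≤ (G.induce P).egirth ∧
        ∀ p ∈ P, ∀ v ∈ S'.1, p ≠ v ∧ (G.Adj p v ↔ b) := by
    rintro ⟨S, hS⟩ n
    obtain ⟨P, S', b, h1, h2, h3, h4, h5, h6⟩ := exists_piece.{u, w} (m := L + 1) hS
      (fun W' F' hW' hF' => hcont S hS ⟨W', F'⟩ ⟨hW', hFg'.trans (le_trans (by
        rw [← hL]; exact_mod_cast Nat.le_succ L) hF')⟩) n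
    exact ⟨P, ⟨S', h5⟩, b, h1, h2, h3, h4, h6⟩
  choose P next b hPS hnext hPn hPg hPb using hstep
  have hV : InfiniteChromatic (G.induce Set.univ) := by
    rw [infiniteChromatic_iff] at hG ⊢
    exact fun n hn => hG n (hn.of_hom (induceUnivIso G).symm.toHom)
  let S : ℕ → {S : Set V // InfiniteChromatic (G.induce S)} :=
    fun n => Nat.rec ⟨Set.univ, hV⟩ (fun n S => next S n) n
  have hSanti : Antitone fun n => (S n).1 := antitone_nat_of_succ_le fun n => hnext (S n) n
  let Q : ℕ → Set V := fun n => P (S n) n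
  have hQ : ∀ i j, i < j → ∀ p ∈ Q i, ∀ v ∈ Q j, p ≠ v ∧ (G.Adj p v ↔ b (S i) i) :=
    fun i j hij p hp v hv => hPb (S i) i p hp v (hSanti hij (hPS (S j) j hv))
  obtain ⟨β, N, hN, hNβ⟩ : ∃ (β : Prop) (N : Set ℕ), N.Infinite ∧ ∀ n ∈ N, (b (S n) n ↔ β) := by
    by_cases hfin : {n | b (S n) n}.Finite
    · exact ⟨False, _, hfin.infinite_compl, fun n hn => iff_false_intro hn⟩
    · exact ⟨True, _, hfin, fun n hn => iff_true_intro hn⟩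
  -- Piece n is not n-colourable, and `N` is unbounded.
  have hU : InfiniteChromatic (G.induce (⋃ n ∈ N, Q n)) := by
    rw [infiniteChromatic_iff]
    intro n hn
    obtain ⟨k, hk, hnk⟩ := hN.exists_gt n
    exact hPn (S k) k ((hn.of_hom (induce_isIndContained_induce G
      (Set.subset_biUnion_of_mem (u := Q) hk)).some.toHom).mono hnk.le)
  obtain ⟨f⟩ := hcont _ hU ⟨W, F⟩ ⟨hW, hFg'⟩
  have hmem : ∀ x, ∃ n ∈ N, (f x : V) ∈ Q n := fun x => by
    obtain ⟨n, hn, hx⟩ := Set.mem_iUnion₂.1 (f x).2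
    exact ⟨n, hn, hx⟩
  choose idx hidxN hidx using hmem
  have hadj : ∀ x y, idx x ≠ idx y → (G.Adj (f x) (f y) ↔ β) := by
    intro x y hxy
    rcases lt_or_gt_of_ne hxy with h | h
    · exact ((hQ _ _ h _ (hidx x) _ (hidx y)).2).trans (hNβ _ (hidxN x))
    · exact (G.adj_comm _ _).trans
        (((hQ _ _ h _ (hidx y) _ (hidx x)).2).trans (hNβ _ (hidxN y)))
  obtain ⟨x, hx⟩ :=
    exists_egirth_induce_le hF4 hF2 ((Embedding.induce _).comp f) Q β idx hidx hadj
  have h := (hPg (S (idx x)) (idx x)).trans hx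
  rw [← hL] at h
  have h' : L + 1 ≤ L := by exact_mod_cast h
  omega
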